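/- Let $G$ be a finite group, and let $A$ be a torsion abelian group (every element has finite order) equipped with an action of $G$ by group automorphisms. Let $n \ge 2$, and let $\omega : G^n \to A$ be an (inhomogeneous) $n$-cocycle for $G$ with coefficients in $A$, i.e. $d\omega = 0$, where for a map $\beta : G^m \to A$ the map $d\beta : G^{m+1} \to A$ is given by $$(d\beta)(g_0,\dots,g_m) = g_0\cdot\beta(g_1,\dots,g_m) + \sum_{j=0}^{m-1} (-1)^{j+1}\beta(g_0,\dots,g_jg_{j+1},\dots,g_m) + (-1)^{m+1}\beta(g_0,\dots,g_{m-1}).$$ Then there exist a finite group $\widetilde{G}$ and a surjective group homomorphism $p : \widetilde{G} \to G$ such that the pullback $p^*\omega$, $(p^*\omega)(h_1,\dots,h_n) = \omega(p(h_1),\dots,p(h_n))$, is a coboundary, that is, $p^*\omega = d\beta$ for some map $\beta : \widetilde{G}^{\,n-1} \to A$, where $\widetilde{G}$ acts on $A$ through $p$. -/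

import Mathlib

universe u v

/-- The differential `Cⁿ(G, A) → Cⁿ⁺¹(G, A)` of inhomogeneous cochains of a group `G` with
coefficients in an abelian group `A` on which `G` acts by `ρ`:
`(dω)(g₀, …, gₙ) = g₀ • ω(g₁, …, gₙ) + ∑_{j < n} (-1)^(j+1) ω(g₀, …, gⱼ gⱼ₊₁, …, gₙ)
  + (-1)^(n+1) ω(g₀, …, gₙ₋₁)`.
The map `Fin.contractNth j` multiplies the entries `j` and `j + 1` for `j < n`, and drops the last
entry for `j = n`. -/
def groupCochainDifferential {G : Type u} [Group G] {A : Type v} [AddCommGroup A]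
    (ρ : Representation ℤ G A) (n : ℕ) (ω : (Fin n → G) → A) : (Fin (n + 1) → G) → A :=
  fun g => ρ (g 0) (ω fun i => g i.succ) +
    ∑ j : Fin (n + 1), (-1 : ℤ) ^ ((j : ℕ) + 1) • ω (Fin.contractNth j (· * ·) g)

/-- An `n`-cocycle of `G` with coefficients in `(A, ρ)`. -/
def IsGroupCocycle {G : Type u} [Group G] {A : Type v} [AddCommGroup A]
    (ρ : Representation ℤ G A) (n : ℕ) (ω : (Fin n → G) → A) : Prop :=
  groupCochainDifferential ρ n ω = 0

/-- An `n`-coboundary of `G` with coefficients in `(A, ρ)`. In degree `0` only the zero cochain is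
a coboundary. -/
def IsGroupCoboundary {G : Type u} [Group G] {A : Type v} [AddCommGroup A]
    (ρ : Representation ℤ G A) : (n : ℕ) → ((Fin n → G) → A) → Prop
  | 0, ω => ω = 0
  | n + 1, ω => ∃ β : (Fin n → G) → A, groupCochainDifferential ρ n β = ω

/-- The pullback `(p^*ω)(h₁, …, hₙ) = ω(p h₁, …, p hₙ)` of a cochain along a group
homomorphism. It is a cochain with coefficients in `A` with the action pulled back along `p`. -/
def groupCochainPullback {G H : Type u} [Group G] [Group H] {A : Type v} (p : H →* G) {n : ℕ}
    (ω : (Fin n → G) → A) : (Fin n → H) → A :=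
  fun h => ω fun i => p (h i)

/-- The differential above is Mathlib's differential of inhomogeneous cochains, at the universe
level at which the latter is available. -/
theorem groupCochainDifferential_eq {G : Type} [Group G] {A : Type} [AddCommGroup A]
    (ρ : Representation ℤ G A) (n : ℕ) (ω : (Fin n → G) → A) :
    groupCochainDifferential ρ n ω = (inhomogeneousCochains.d (Rep.of ρ) n).hom ω := by
  funext g
  exact (inhomogeneousCochains.d_hom_apply (Rep.of ρ) n ω g).symm

/-! Dimension shifting reduces everything to degree 2. Embed `A` in the functions `G → A` by the
orbit map. Currying a cocycle `ω` gives a cochain one degree lower with differential `orbitMap ρ ∘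
ω` (`curryCochain_differential`), so it becomes a cocycle modulo the image of `A`. The quotient is
again torsion because `G` is finite. If a finite cover makes that cocycle `dψ`, then the pulled-back
curried cochain minus a lift of `dψ` takes values in `A`, and its differential is the pullback of
`ω`.

In degree 2, `ω` takes values in a finite `G`-stable subgroup, and it becomes a coboundary on the
finite extension of `G` that it defines. -/

section Functoriality

variable {G H : Type u} [Group G] [Group H]

/-- The differential of inhomogeneous cochains is natural in the coefficients. -/
theorem groupCochainDifferential_map {A B : Type*} [AddCommGroup A] [AddCommGroup B]
    {ρ : Representation ℤ G A} {σ : Representation ℤ G B} (f : A →ₗ[ℤ] B)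
    (hf : ∀ g a, f (ρ g a) = σ g (f a)) (n : ℕ) (ω : (Fin n → G) → A) :
    groupCochainDifferential σ n (fun g => f (ω g)) =
      fun g => f (groupCochainDifferential ρ n ω g) := by
  funext g
  simp only [groupCochainDifferential, map_add, map_sum, map_smul, hf]

/-- The differential of inhomogeneous cochains is additive. -/
theorem groupCochainDifferential_sub {A : Type*} [AddCommGroup A]
    (ρ : Representation ℤ G A) (n : ℕ) (ω η : (Fin n → G) → A) :
    groupCochainDifferential ρ n (ω - η) =
      groupCochainDifferential ρ n ω - groupCochainDifferential ρ n η := by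
  funext g
  simp only [groupCochainDifferential, Pi.sub_apply, map_sub, smul_sub, Finset.sum_sub_distrib]
  abel

/-- The differential of inhomogeneous cochains commutes with pullback. -/
theorem groupCochainDifferential_pullback {A : Type*} [AddCommGroup A]
    (ρ : Representation ℤ G A) (p : H →* G) (n : ℕ) (ω : (Fin n → G) → A) :
    groupCochainDifferential (ρ.comp p : Representation ℤ H A) n (groupCochainPullback p ω) =
      groupCochainPullback p (groupCochainDifferential ρ n ω) := by
  funext g
  have h (j : Fin (n + 1)) : (fun i => p (Fin.contractNth j (· * ·) g i)) =
      Fin.contractNth j (· * ·) fun i => p (g i) := by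
    funext i
    simp only [Fin.contractNth]
    split_ifs <;> simp
  simp only [groupCochainDifferential, groupCochainPullback, h]
  rfl

/-- A cochain of positive degree which becomes a coboundary on some finite group surjecting
onto `G`. -/
def IsCoboundaryOnFiniteCover {A : Type*} [AddCommGroup A] (ρ : Representation ℤ G A) (n : ℕ)
    (ω : (Fin (n + 1) → G) → A) : Prop :=
  ∃ (H : Type u) (_ : Group H) (_ : Finite H) (p : H →* G),
    Function.Surjective p ∧
      IsGroupCoboundary (ρ.comp p : Representation ℤ H A) (n + 1) (groupCochainPullback p ω)

theorem IsCoboundaryOnFiniteCover.map {A B : Type*} [AddCommGroup A] [AddCommGroup B]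
    {ρ : Representation ℤ G A} {σ : Representation ℤ G B} (f : A →ₗ[ℤ] B)
    (hf : ∀ g a, f (ρ g a) = σ g (f a)) {n : ℕ} {ω : (Fin (n + 1) → G) → A}
    (h : IsCoboundaryOnFiniteCover ρ n ω) :
    IsCoboundaryOnFiniteCover σ n fun g => f (ω g) := by
  obtain ⟨H, _, _, p, hp, β, hβ⟩ := h
  refine ⟨H, inferInstance, inferInstance, p, hp, fun g => f (β g), ?_⟩
  rw [groupCochainDifferential_map (ρ := (ρ.comp p : Representation ℤ H A)) f
    (fun g a => hf (p g) a), hβ]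
  rfl

end Functoriality

/-- Currying in the first variable. -/
def curryCochain {G : Type u} {A : Type v} {n : ℕ}
    (ω : (Fin (n + 1) → G) → A) : (Fin n → G) → G → A :=
  fun g x => ω (Fin.cons x g)

theorem curryCochain_injective {G : Type u} {A : Type v} {n : ℕ} :
    Function.Injective (curryCochain : ((Fin (n + 1) → G) → A) → _) := by
  intro ω η h
  funext g
  have := congrFun (congrFun h (Fin.tail g)) (g 0)
  simpa [curryCochain] using this

section DimensionShifting

variable {G : Type u} [Group G] {A : Type v} [AddCommGroup A]

/-- The functions `G → A`, on which `G` acts by right translation. -/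
def translationRepresentation (G : Type u) [Group G] (A : Type v) [AddCommGroup A] :
    Representation ℤ G (G → A) where
  toFun g := LinearMap.funLeft ℤ A (· * g)
  map_one' := by ext; simp [LinearMap.funLeft_apply]
  map_mul' g h := by ext; simp [LinearMap.funLeft_apply, mul_assoc]

@[simp]
theorem translationRepresentation_apply (g : G) (f : G → A) (x : G) :
    translationRepresentation G A g f x = f (x * g) :=
  rfl

/-- The orbit map `a ↦ (x ↦ x • a)`, embedding `A` into the functions `G → A`. -/
def orbitMap (ρ : Representation ℤ G A) : A →ₗ[ℤ] (G → A) :=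
  LinearMap.pi fun x => ρ x

@[simp]
theorem orbitMap_apply (ρ : Representation ℤ G A) (a : A) (x : G) : orbitMap ρ a x = ρ x a :=
  rfl

theorem orbitMap_equivariant (ρ : Representation ℤ G A) (g : G) (a : A) :
    orbitMap ρ (ρ g a) = translationRepresentation G A g (orbitMap ρ a) := by
  funext x
  simp

theorem orbitMap_injective (ρ : Representation ℤ G A) : Function.Injective (orbitMap ρ) := by
  intro a b h
  simpa using congrFun h 1

theorem contractNth_zero_cons {n : ℕ} (x : G) (g : Fin (n + 1) → G) :
    Fin.contractNth 0 (· * ·) (Fin.cons x g : Fin (n + 2) → G) =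
      Fin.cons (x * g 0) fun i => g i.succ := by
  funext i
  refine Fin.cases ?_ (fun i => ?_) i <;> simp [Fin.contractNth]

theorem contractNth_succ_cons {n : ℕ} (j : Fin (n + 1)) (x : G) (g : Fin (n + 1) → G) :
    Fin.contractNth j.succ (· * ·) (Fin.cons x g : Fin (n + 2) → G) =
      Fin.cons x (Fin.contractNth j (· * ·) g) := by
  funext i
  refine Fin.cases ?_ (fun i => ?_) i <;> simp [Fin.contractNth]

/-- Currying is a contracting homotopy, up to the embedding into functions on `G`. -/
theorem curryCochain_differential (ρ : Representation ℤ G A) (n : ℕ)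
    (ω : (Fin (n + 1) → G) → A) :
    curryCochain (groupCochainDifferential ρ (n + 1) ω) =
      (fun g => orbitMap ρ (ω g)) -
        groupCochainDifferential (translationRepresentation G A) n (curryCochain ω) := by
  funext g x
  simp only [curryCochain, groupCochainDifferential, Pi.sub_apply, Pi.add_apply,
    Finset.sum_apply, Pi.smul_apply, orbitMap_apply, translationRepresentation_apply]
  rw [Fin.sum_univ_succ, contractNth_zero_cons]
  simp only [contractNth_succ_cons, Fin.cons_zero, Fin.cons_succ, Fin.val_zero, Fin.val_succ,
    pow_succ _ (_ + 1), mul_neg, mul_one, neg_smul, Finset.sum_neg_distrib]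
  simp only [zero_add, pow_one, neg_smul, one_smul]
  abel

end DimensionShifting

/-- Coboundaries are cocycles. -/
theorem groupCochainDifferential_comp_self {G : Type u} [Group G] (n : ℕ)
    {A : Type (max u v)} [AddCommGroup A] (ρ : Representation ℤ G A) (ω : (Fin n → G) → A) :
    groupCochainDifferential ρ (n + 1) (groupCochainDifferential ρ n ω) = 0 := by
  induction n generalizing A with
  | zero =>
    funext g
    have h (x : Fin 0 → G) : ω x = ω default := congrArg ω (Subsingleton.elim _ _)
    simp [groupCochainDifferential, Fin.sum_univ_succ, h, Fin.contractNth]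
    abel
  | succ n ih =>
    apply curryCochain_injective
    -- Currying twice leaves `orbitMap ∘ dω - d(orbitMap ∘ ω)` plus a double differential in lower
    -- degree, with coefficients in `G → A`.
    rw [curryCochain_differential, curryCochain_differential, groupCochainDifferential_sub, ih,
      sub_zero, groupCochainDifferential_map _ (orbitMap_equivariant ρ), sub_self]
    rfl

section Extension

variable {G : Type u} [Group G] {A : Type v} [AddCommGroup A]

/-- The underlying set of the extension of `G` by `A` attached to a `2`-cocycle. -/
@[ext]
structure CocycleExtension (G : Type u) (A : Type v) where
  /-- The component in `A`. -/
  left : A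
  /-- The image in `G`. -/
  right : G

instance [Finite G] [Finite A] : Finite (CocycleExtension G A) :=
  Finite.of_injective (fun x => (x.left, x.right)) fun x y h => by
    simp only [Prod.mk.injEq] at h
    exact CocycleExtension.ext h.1 h.2

/-- The multiplication `(a, g) (b, h) = (a + g • b + c(g, h), g h)`. -/
abbrev CocycleExtension.group (ρ : Representation ℤ G A) (c : G → G → A)
    (hc : ∀ g h k, ρ g (c h k) + c g (h * k) = c g h + c (g * h) k) :
    Group (CocycleExtension G A) :=
  letI : Mul (CocycleExtension G A) :=
    ⟨fun x y => ⟨x.left + ρ x.right y.left + c x.right y.right, x.right * y.right⟩⟩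
  -- The cocycle is not assumed normalized, hence the correction by `c 1 1`.
  letI : One (CocycleExtension G A) := ⟨⟨-c 1 1, 1⟩⟩
  letI : Inv (CocycleExtension G A) :=
    ⟨fun x => ⟨-c 1 1 - ρ x.right⁻¹ x.left - c x.right⁻¹ x.right, x.right⁻¹⟩⟩
  Group.ofLeftAxioms
    (fun x y z => by
      refine CocycleExtension.ext ?_ (mul_assoc _ _ _)
      change x.left + ρ x.right y.left + c x.right y.right +
          ρ (x.right * y.right) z.left + c (x.right * y.right) z.right =
        x.left + ρ x.right (y.left + ρ y.right z.left + c y.right z.right) +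
          c x.right (y.right * z.right)
      rw [map_add, map_add, map_mul, Module.End.mul_apply,
        eq_sub_of_add_eq' (hc x.right y.right z.right).symm]
      abel)
    (fun x => by
      refine CocycleExtension.ext ?_ (one_mul _)
      change -c 1 1 + ρ 1 x.left + c 1 x.right = x.left
      have := hc 1 1 x.right
      simp only [map_one, Module.End.one_apply, one_mul, add_left_inj] at this ⊢
      rw [this]
      abel)
    (fun x => by
      refine CocycleExtension.ext ?_ (inv_mul_cancel _)
      change -c 1 1 - ρ x.right⁻¹ x.left - c x.right⁻¹ x.right +
        ρ x.right⁻¹ x.left + c x.right⁻¹ x.right = -c 1 1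
      abel)

/-- On the extension defined by `ω`, the multiplication law says exactly that minus the
`A`-coordinate has differential the pullback of `ω`. -/
theorem isCoboundaryOnFiniteCover_of_finite [Finite G] [Finite A] (ρ : Representation ℤ G A)
    (ω : (Fin 2 → G) → A) (hω : IsGroupCocycle ρ 2 ω) : IsCoboundaryOnFiniteCover ρ 1 ω := by
  have hc (g h k : G) : ρ g (ω ![h, k]) + ω ![g, h * k] = ω ![g, h] + ω ![g * h, k] := by
    have e₀ : (fun i : Fin 2 => (![g, h, k] : Fin 3 → G) i.succ) = ![h, k] := by
      funext i; fin_cases i <;> rfl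
    have e₁ : Fin.contractNth 0 (· * ·) (![g, h, k] : Fin 3 → G) = ![g * h, k] := by
      funext i; fin_cases i <;> rfl
    have e₂ : Fin.contractNth 1 (· * ·) (![g, h, k] : Fin 3 → G) = ![g, h * k] := by
      funext i; fin_cases i <;> rfl
    have e₃ : Fin.contractNth 2 (· * ·) (![g, h, k] : Fin 3 → G) = ![g, h] := by
      funext i; fin_cases i <;> rfl
    have hd : ρ g (ω fun i : Fin 2 => (![g, h, k] : Fin 3 → G) i.succ) +
        ∑ j : Fin 3, (-1 : ℤ) ^ ((j : ℕ) + 1) •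
          ω (Fin.contractNth j (· * ·) (![g, h, k] : Fin 3 → G)) = 0 :=
      congrFun hω ![g, h, k]
    rw [Fin.sum_univ_three, e₀, e₁, e₂, e₃] at hd
    rw [← sub_eq_zero, ← hd]
    simp
    abel
  let := CocycleExtension.group ρ (fun g h => ω ![g, h]) hc
  let q : CocycleExtension G A →* G :=
    { toFun := CocycleExtension.right, map_one' := rfl, map_mul' := fun _ _ => rfl }
  -- The cover must live in the universe of `G`.
  let e : Shrink.{u} (CocycleExtension G A) ≃* CocycleExtension G A := Shrink.mulEquiv
  refine ⟨Shrink.{u} (CocycleExtension G A), inferInstance, inferInstance,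
    q.comp e.toMonoidHom, fun g => ⟨e.symm ⟨0, g⟩, ?_⟩, fun x => -(e (x 0)).left, ?_⟩
  · simp [q]
  · funext x
    have h : (fun i => q (e (x i))) = ![(e (x 0)).right, (e (x 1)).right] := by
      funext i; fin_cases i <;> rfl
    have hmul : (e (x 0 * x 1)).left = (e (x 0)).left + ρ (e (x 0)).right (e (x 1)).left +
        ω ![(e (x 0)).right, (e (x 1)).right] := by
      rw [map_mul]
      rfl
    change ρ (e (x 0)).right (-(e (x 1)).left) + _ = ω (fun i => q (e (x i)))
    rw [h]
    simp [-map_mul, Fin.sum_univ_two, Fin.contractNth, hmul]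
    abel

theorem isCoboundaryOnFiniteCover_two [Finite G] (hA : IsAddTorsion A) (ρ : Representation ℤ G A)
    (ω : (Fin 2 → G) → A) (hω : IsGroupCocycle ρ 2 ω) : IsCoboundaryOnFiniteCover ρ 1 ω := by
  -- All translates of the finitely many values of `ω`: `S` is `G`-stable, finitely generated and
  -- torsion, hence finite.
  let S : Submodule ℤ A :=
    Submodule.span ℤ (Set.range fun x : G × (Fin 2 → G) => ρ x.1 (ω x.2))
  have hS (g : G) : ∀ a ∈ S, ρ g a ∈ S := by
    change S ≤ S.comap (ρ g)
    refine Submodule.span_le.2 ?_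
    rintro _ ⟨x, rfl⟩
    exact Submodule.subset_span ⟨(g * x.1, x.2), by simp⟩
  have hωS (x : Fin 2 → G) : ω x ∈ S := Submodule.subset_span ⟨(1, x), by simp⟩
  have : Module.Finite ℤ S := Module.Finite.span_of_finite ℤ (Set.finite_range _)
  have : AddGroup.FG S := Module.Finite.iff_addGroup_fg.1 this
  have : Finite S :=
    AddCommGroup.finite_of_fg_isAddTorsion S (hA.addSubgroup S.toAddSubgroup)
  let σ : Representation ℤ G S :=
    { toFun := fun g => (ρ g).restrict (hS g)
      map_one' := by ext; simp
      map_mul' := fun g h => by ext; simp }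
  have hcoe (g : G) (a : S) : S.subtype (σ g a) = ρ g (S.subtype a) := rfl
  refine (isCoboundaryOnFiniteCover_of_finite σ (fun x => ⟨ω x, hωS x⟩) ?_).map S.subtype hcoe
  funext g
  apply S.subtype_injective
  have := congrFun (groupCochainDifferential_map S.subtype hcoe 2 fun x => ⟨ω x, hωS x⟩) g
  rw [← this]
  exact congrFun hω g

end Extension

/-- The universe `max u v` is stable under passing from `A` to quotients of `G → A`, as the
induction requires. -/
theorem isCoboundaryOnFiniteCover {G : Type u} [Group G] [Finite G] (n : ℕ)
    {A : Type (max u v)} [AddCommGroup A] (hA : IsAddTorsion A) (ρ : Representation ℤ G A)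
    (ω : (Fin (n + 2) → G) → A) (hω : IsGroupCocycle ρ (n + 2) ω) :
    IsCoboundaryOnFiniteCover ρ (n + 1) ω := by
  induction n generalizing A with
  | zero => exact isCoboundaryOnFiniteCover_two hA ρ ω hω
  | succ n ih =>
    let τ := translationRepresentation G A
    let W : Submodule ℤ (G → A) := LinearMap.range (orbitMap ρ)
    have hW (g : G) : W ≤ W.comap (τ g) := by
      rintro _ ⟨a, rfl⟩
      exact ⟨ρ g a, orbitMap_equivariant ρ g a⟩
    have hM : IsAddTorsion (G → A) := by
      have := Fintype.ofFinite G
      intro f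
      refine isOfFinAddOrder_iff_nsmul_eq_zero.2
        ⟨∏ x, addOrderOf (f x), Finset.prod_pos fun x _ => (hA (f x)).addOrderOf_pos, ?_⟩
      funext x
      exact addOrderOf_dvd_iff_nsmul_eq_zero.1 (Finset.dvd_prod_of_mem _ (Finset.mem_univ x))
    have hB : IsAddTorsion ((G → A) ⧸ W) :=
      hM.of_surjective (f := W.mkQ.toAddMonoidHom) W.mkQ_surjective
    have hφ : groupCochainDifferential τ (n + 2) (curryCochain ω) =
        fun g => orbitMap ρ (ω g) := by
      have := curryCochain_differential ρ (n + 2) ω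
      rw [hω] at this
      exact (sub_eq_zero.1 this.symm).symm
    obtain ⟨H, _, _, p, hp, β', hβ'⟩ := ih hB (τ.quotient W hW)
      (fun g => W.mkQ (curryCochain ω g)) (by
        rw [IsGroupCocycle, groupCochainDifferential_map (ρ := τ) W.mkQ (fun _ _ => rfl), hφ]
        funext g
        exact (Submodule.Quotient.mk_eq_zero W).2 ⟨ω g, rfl⟩)
    choose ψ hψ using fun g => W.mkQ_surjective (β' g)
    obtain rfl : (fun g => W.mkQ (ψ g)) = β' := funext hψ
    have hmap := groupCochainDifferential_map (ρ := (τ.comp p : Representation ℤ H (G → A)))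
      (σ := ((τ.quotient W hW).comp p : Representation ℤ H _)) W.mkQ (fun _ _ => rfl) (n + 1) ψ
    rw [hmap] at hβ'
    have hmem (g : Fin (n + 2) → H) : (groupCochainPullback p (curryCochain ω) -
        groupCochainDifferential (τ.comp p : Representation ℤ H (G → A)) (n + 1) ψ) g ∈ W :=
      (Submodule.Quotient.eq W).1 (congrFun hβ' g).symm
    -- This `β` is the primitive; it is checked after applying the injective orbit map, where `ddψ =
    -- 0` removes the choice of lift `ψ`.
    choose β hβ using hmem
    refine ⟨H, inferInstance, inferInstance, p, hp, β, ?_⟩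
    funext g
    apply orbitMap_injective ρ
    have hd := groupCochainDifferential_map (ρ := (ρ.comp p : Representation ℤ H A))
      (σ := (τ.comp p : Representation ℤ H (G → A))) (orbitMap ρ)
      (fun h a => orbitMap_equivariant ρ (p h) a) (n + 2) β
    rw [funext hβ] at hd
    have hd' := groupCochainDifferential_sub (τ.comp p : Representation ℤ H (G → A)) (n + 2)
      (groupCochainPullback p (curryCochain ω))
      (groupCochainDifferential (τ.comp p : Representation ℤ H (G → A)) (n + 1) ψ)
    rw [groupCochainDifferential_comp_self, sub_zero, groupCochainDifferential_pullback, hφ] at hd'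
    exact congrFun (hd.symm.trans hd') g

theorem mainTheorem12 {G : Type u} [Group G] [Finite G] {A : Type v} [AddCommGroup A]
    (hA : IsAddTorsion A) (ρ : Representation ℤ G A) (n : ℕ) (hn : 2 ≤ n)
    (ω : (Fin n → G) → A) (hω : IsGroupCocycle ρ n ω) :
    ∃ (H : Type u) (_ : Group H) (_ : Finite H) (p : H →* G),
      Function.Surjective p ∧
        IsGroupCoboundary (ρ.comp p : Representation ℤ H A) n (groupCochainPullback p ω) := by
  obtain ⟨n, rfl⟩ := Nat.exists_eq_add_of_le' hn
  let e : ULift.{max u v} A ≃ₗ[ℤ] A := ULift.moduleEquiv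
  let σ : Representation ℤ G (ULift.{max u v} A) :=
    { toFun := fun g => e.symm.toLinearMap ∘ₗ ρ g ∘ₗ e.toLinearMap
      map_one' := by ext; simp
      map_mul' := fun g h => by ext; simp }
  have hσ (g : G) (a : A) : e.symm (ρ g a) = σ g (e.symm a) := by simp [σ]
  have hσ' (g : G) (a : ULift.{max u v} A) : e (σ g a) = ρ g (e a) := by simp [σ]
  refine (isCoboundaryOnFiniteCover n
    (hA.of_surjective (f := e.symm.toLinearMap.toAddMonoidHom) e.symm.surjective) σ
    (fun g => e.symm (ω g)) ?_).map e.toLinearMap hσ'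
  have := groupCochainDifferential_map e.symm.toLinearMap hσ (n + 2) ω
  rw [hω] at this
  exact this.trans (funext fun _ => map_zero _)
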